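/- Let $t_0\in\mathbb R$ and let $p,q,r:[t_0,+\infty)\to\mathbb R$ be continuous with $p(t)>0$ for all $t\ge t_0$. Consider the scalar Riccati equation $$\alpha'(t)+\frac{1}{p(t)}\alpha^2(t)+\frac{q(t)}{p(t)}\alpha(t)+r(t)=0,\qquad t\ge t_0. \tag{1}$$ All solutions are real-valued. A solution of (1) is called $t_0$-regular if it exists on $[t_0,+\infty)$. A $t_0$-regular solution $\alpha$ is called $t_0$-normal if there is a neighbourhood $U$ of $\alpha(t_0)$ such that every solution $\widetilde\alpha$ of (1) with $\widetilde\alpha(t_0)\in U$ is $t_0$-regular; otherwise it is called $t_0$-extremal. A $t_0$-extremal solution $\alpha$ is called lower $t_0$-extremal if no solution $\widetilde\alpha$ of (1) with $\widetilde\alpha(t_0)<\alpha(t_0)$ is $t_0$-regular. For $t\ge t_0$ set $$I(t)=\int_t^{+\infty}\exp\Bigl\{-\int_t^\tau\frac{q(s)}{p(s)}\,ds\Bigr\}\frac{d\tau}{p(\tau)}.$$ Suppose that 1. $r(t)\ge 0$ for all $t\ge t_0$, and $r$ has unbounded support (for every $T$ there is $t\ge \max(T,t_0)$ with $r(t)\neq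 0$); 2. $I(t_0)<+\infty$; 3. equation (1) has a $t_0$-normal solution that is positive on $[t_0,+\infty)$. Then equation (1) has a unique lower $t_0$-extremal solution $\alpha_*$ on $[t_0,+\infty)$, and $$\alpha_*(t)>-\frac{1}{I(t)}\qquad\text{for all } t\ge t_0.$$ -/

import Mathlib

open Set Filter Topology MeasureTheory

namespace Riccati

/-- `y` solves `y' + (1/p) y² + (q/p) y + r = 0` on the interval `J`
(one-sided derivative at an end point of `J` that belongs to `J`). -/
def IsSolutionOn (p q r : ℝ → ℝ) (J : Set ℝ) (y : ℝ → ℝ) : Prop :=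
  ∀ t ∈ J, HasDerivWithinAt y (-(1 / p t * y t ^ 2 + q t / p t * y t + r t)) J t

/-- `y` is a `t₁`-regular solution: a solution on all of `[t₁, ∞)`. -/
def IsRegular (p q r : ℝ → ℝ) (t₁ : ℝ) (y : ℝ → ℝ) : Prop :=
  IsSolutionOn p q r (Ici t₁) y

/-- A solution `y` known on `[t₁, T)` exists on `[t₁, ∞)`, i.e. it is the restriction of a
`t₁`-regular solution. -/
def ExtendsToRegular (p q r : ℝ → ℝ) (t₁ T : ℝ) (y : ℝ → ℝ) : Prop :=
  ∃ z : ℝ → ℝ, IsRegular p q r t₁ z ∧ EqOn z y (Ico t₁ T)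

/-- `y` is a `t₁`-normal solution: it is `t₁`-regular, and every solution (a priori given only on
some `[t₁, T)`) whose value at `t₁` lies in a suitable neighbourhood of `y t₁` is `t₁`-regular. -/
def IsNormal (p q r : ℝ → ℝ) (t₁ : ℝ) (y : ℝ → ℝ) : Prop :=
  IsRegular p q r t₁ y ∧
    ∃ U ∈ 𝓝 (y t₁), ∀ (T : ℝ) (z : ℝ → ℝ), t₁ < T → IsSolutionOn p q r (Ico t₁ T) z →
      z t₁ ∈ U → ExtendsToRegular p q r t₁ T z

/-- `y` is a `t₁`-extremal solution: it is `t₁`-regular but not `t₁`-normal. -/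
def IsExtremal (p q r : ℝ → ℝ) (t₁ : ℝ) (y : ℝ → ℝ) : Prop :=
  IsRegular p q r t₁ y ∧ ¬ IsNormal p q r t₁ y

/-- `y` is a lower `t₁`-extremal solution: it is `t₁`-extremal, and no solution whose value at
`t₁` is less than `y t₁` is `t₁`-regular. -/
def IsLowerExtremal (p q r : ℝ → ℝ) (t₁ : ℝ) (y : ℝ → ℝ) : Prop :=
  IsExtremal p q r t₁ y ∧
    ∀ (T : ℝ) (z : ℝ → ℝ), t₁ < T → IsSolutionOn p q r (Ico t₁ T) z →
      z t₁ < y t₁ → ¬ ExtendsToRegular p q r t₁ T z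

/-- The integrand `τ ↦ exp (-∫ₜ^τ q/p) / p τ` of `I(t)`. -/
noncomputable def integrandI (p q : ℝ → ℝ) (t τ : ℝ) : ℝ :=
  Real.exp (-∫ s in t..τ, q s / p s) * (1 / p τ)

/-- `I(t) = ∫ₜ^∞ exp (-∫ₜ^τ q/p) dτ / p τ`. The integrand is positive, so `I(t) < ∞` is
integrability of `integrandI p q t` on `(t, ∞)`. -/
noncomputable def I (p q : ℝ → ℝ) (t : ℝ) : ℝ :=
  ∫ τ in Ioi t, integrandI p q t τ

end Riccati

namespace Riccati

/-! Relative to the positive solution `a`, the equation for `α - a` is of Bernoulli type: initial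
offset `δ` gives `δ exp (-A) / (1 + δ N)`, with `A' = (2a + q)/p`, `N' = exp (-A)/p`. For `δ < 0`
this is global iff `1 + δ N` never vanishes. Positivity of `a` gives `N ≤ H ≤ I t₀`, where `H` is
the analogue of `N` for `a = r = 0`; hence `ν = sup N` is finite and `δ = -1/ν` is the lowest global
offset (`exists_isLowerExtremal`). Two lowest solutions agree at `t₀`, hence everywhere. For the
bound (`IsRegular.neg_one_div_I_lt`), `H - exp (-Q)/y` is constant along negative solutions when `r
= 0` and decreases when `r ≥ 0`; it is applied from each initial time `t`. -/

lemma exists_primitive {f : ℝ → ℝ} {a : ℝ} (hf : ContinuousOn f (Ici a)) :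
    ∃ F : ℝ → ℝ, F a = 0 ∧ (∀ t ∈ Ici a, HasDerivWithinAt F (f t) (Ici a) t) ∧
      ∀ s ∈ Ici a, ∀ t ∈ Ici a, ∫ x in s..t, f x = F t - F s := by
  -- Constant extension to the left of `a` gives a globally continuous integrand.
  set g : ℝ → ℝ := fun x => f (max a x) with hgdef
  have hg : Continuous g :=
    hf.comp_continuous (continuous_const.max continuous_id) fun x => le_max_left a x
  have hfg : ∀ x ∈ Ici a, g x = f x := fun x hx => by
    simp only [hgdef, max_eq_right (show a ≤ x from hx)]
  refine ⟨fun t => ∫ x in a..t, g x, by simp, fun t ht => ?_, fun s hs t ht => ?_⟩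
  · rw [← hfg t ht]
    exact (hg.integral_hasStrictDerivAt a t).hasDerivAt.hasDerivWithinAt
  · rw [intervalIntegral.integral_interval_sub_left (hg.intervalIntegrable _ _)
      (hg.intervalIntegrable _ _)]
    refine intervalIntegral.integral_congr fun x hx => (hfg x ?_).symm
    exact le_trans (le_min hs ht) hx.1

lemma eq_of_hasDerivWithinAt_zero {f : ℝ → ℝ} {a : ℝ}
    (hf : ∀ t ∈ Ici a, HasDerivWithinAt f 0 (Ici a) t) {t : ℝ} (ht : a ≤ t) : f t = f a := by
  refine constant_of_has_deriv_right_zero (b := t)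
    (fun x hx => ((hf x hx.1).continuousWithinAt).mono Icc_subset_Ici_self)
    (fun x hx => (hf x hx.1).mono (Ici_subset_Ici.mpr hx.1)) t ⟨ht, le_rfl⟩

lemma strictMonoOn_Ici {f f' : ℝ → ℝ} {a : ℝ}
    (hf : ∀ t ∈ Ici a, HasDerivWithinAt f (f' t) (Ici a) t) (hf' : ∀ t ∈ Ici a, 0 < f' t) :
    StrictMonoOn f (Ici a) :=
  strictMonoOn_of_hasDerivWithinAt_pos (convex_Ici a) (fun t ht => (hf t ht).continuousWithinAt)
    (fun t ht => (hf t (interior_subset ht)).mono interior_subset)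
    (fun t ht => hf' t (interior_subset ht))

lemma monotoneOn_Ici {f f' : ℝ → ℝ} {a : ℝ}
    (hf : ∀ t ∈ Ici a, HasDerivWithinAt f (f' t) (Ici a) t) (hf' : ∀ t ∈ Ici a, 0 ≤ f' t) :
    MonotoneOn f (Ici a) :=
  monotoneOn_of_hasDerivWithinAt_nonneg (convex_Ici a)
    (fun t ht => (hf t ht).continuousWithinAt)
    (fun t ht => (hf t (interior_subset ht)).mono interior_subset)
    (fun t ht => hf' t (interior_subset ht))

lemma antitoneOn_Ici {f f' : ℝ → ℝ} {a : ℝ}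
    (hf : ∀ t ∈ Ici a, HasDerivWithinAt f (f' t) (Ici a) t) (hf' : ∀ t ∈ Ici a, f' t ≤ 0) :
    AntitoneOn f (Ici a) :=
  antitoneOn_of_hasDerivWithinAt_nonpos (convex_Ici a)
    (fun t ht => (hf t ht).continuousWithinAt)
    (fun t ht => (hf t (interior_subset ht)).mono interior_subset)
    (fun t ht => hf' t (interior_subset ht))

variable {p q r : ℝ → ℝ} {t₀ : ℝ}

lemma IsRegular.continuousOn {y : ℝ → ℝ} (hy : IsRegular p q r t₀ y) :
    ContinuousOn y (Ici t₀) :=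
  fun t ht => (hy t ht).continuousWithinAt

lemma IsSolutionOn.mono {y : ℝ → ℝ} {J K : Set ℝ} (hy : IsSolutionOn p q r J y) (hK : K ⊆ J) :
    IsSolutionOn p q r K y :=
  fun t ht => (hy t (hK ht)).mono hK

/-! ### Comparing solutions; Bernoulli substitution -/

/-- The difference of two regular solutions solves a homogeneous linear equation. -/
lemma IsRegular.exists_sub_mul_exp_eq {y z : ℝ → ℝ} (hy : IsRegular p q r t₀ y)
    (hz : IsRegular p q r t₀ z) (hp : ContinuousOn p (Ici t₀)) (hq : ContinuousOn q (Ici t₀))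
    (hp_pos : ∀ t, t₀ ≤ t → 0 < p t) :
    ∃ F : ℝ → ℝ, ∀ t ∈ Ici t₀, (z t - y t) * Real.exp (F t) = z t₀ - y t₀ := by
  have hpne : ∀ t ∈ Ici t₀, p t ≠ 0 := fun t ht => (hp_pos t ht).ne'
  obtain ⟨F, hF0, hF, -⟩ := exists_primitive
    (((hy.continuousOn.add hz.continuousOn).add hq).div hp hpne)
  refine ⟨F, fun t ht => ?_⟩
  have := eq_of_hasDerivWithinAt_zero (f := fun t => (z t - y t) * Real.exp (F t)) (a := t₀)
    (fun s hs => by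
      refine (((hz s hs).sub (hy s hs)).mul (hF s hs).exp).congr_deriv ?_
      have := hpne s hs
      simp only [Pi.add_apply, Pi.sub_apply, Pi.div_apply]
      field_simp
      ring) ht
  simpa [hF0] using this

lemma IsRegular.eqOn {y z : ℝ → ℝ} (hy : IsRegular p q r t₀ y)
    (hz : IsRegular p q r t₀ z) (hp : ContinuousOn p (Ici t₀)) (hq : ContinuousOn q (Ici t₀))
    (hp_pos : ∀ t, t₀ ≤ t → 0 < p t) (h : z t₀ = y t₀) : EqOn z y (Ici t₀) := by
  intro t ht
  obtain ⟨F, hF⟩ := hy.exists_sub_mul_exp_eq hz hp hq hp_pos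
  have := hF t ht
  rw [h, sub_self, mul_eq_zero] at this
  exact sub_eq_zero.mp (this.resolve_right (Real.exp_ne_zero _))

/-- The Bernoulli substitution produces a family of solutions from a known solution `a`. -/
lemma IsSolutionOn.add_div {a A N : ℝ → ℝ} {J : Set ℝ} (ha : IsSolutionOn p q r J a)
    (hA : ∀ t ∈ J, HasDerivWithinAt A ((2 * a t + q t) / p t) J t)
    (hN : ∀ t ∈ J, HasDerivWithinAt N (Real.exp (-A t) / p t) J t)
    (hp : ∀ t ∈ J, p t ≠ 0) (δ : ℝ) (hδ : ∀ t ∈ J, 1 + δ * N t ≠ 0) :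
    IsSolutionOn p q r J (fun t => a t + δ * Real.exp (-A t) / (1 + δ * N t)) := by
  intro t ht
  refine ((ha t ht).add ((((hA t ht).neg.exp).const_mul δ).div
    (((hN t ht).const_mul δ).const_add 1) (hδ t ht))).congr_deriv ?_
  have h1 := hp t ht
  have h2 := hδ t ht
  simp only [Pi.neg_apply]
  field_simp
  ring

/-- A regular solution starting below the regular solution `a` cannot start too low. -/
lemma IsRegular.mul_lt_one {a z A N : ℝ → ℝ} (ha : IsRegular p q r t₀ a)
    (hz : IsRegular p q r t₀ z) (hp : ContinuousOn p (Ici t₀)) (hq : ContinuousOn q (Ici t₀))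
    (hp_pos : ∀ t, t₀ ≤ t → 0 < p t)
    (hA0 : A t₀ = 0) (hN0 : N t₀ = 0)
    (hA : ∀ t ∈ Ici t₀, HasDerivWithinAt A ((2 * a t + q t) / p t) (Ici t₀) t)
    (hN : ∀ t ∈ Ici t₀, HasDerivWithinAt N (Real.exp (-A t) / p t) (Ici t₀) t)
    (hlt : z t₀ < a t₀) {t : ℝ} (ht : t₀ ≤ t) : (a t₀ - z t₀) * N t < 1 := by
  obtain ⟨F, hF⟩ := ha.exists_sub_mul_exp_eq hz hp hq hp_pos
  have hneg : ∀ s ∈ Ici t₀, z s - a s < 0 := fun s hs => by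
    have h := hF s hs
    by_contra! hc
    have := mul_nonneg hc (Real.exp_pos (F s)).le
    linarith
  -- The reciprocal of `z - a` satisfies a linear equation, whose integrated form is this conserved
  -- quantity.
  have := eq_of_hasDerivWithinAt_zero
    (f := fun t => Real.exp (-A t) / (z t - a t) - N t) (a := t₀)
    (fun s hs => by
      have h1 := (hneg s hs).ne
      have h2 := (hp_pos s hs).ne'
      refine (((hA s hs).neg.exp.div ((hz s hs).sub (ha s hs)) h1).sub (hN s hs)).congr_deriv ?_
      simp only [Pi.sub_apply, Pi.neg_apply]
      field_simp
      ring) ht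
  simp only [hA0, hN0, neg_zero, Real.exp_zero, sub_zero] at this
  have h3 : Real.exp (-A t) / (z t - a t) < 0 :=
    div_neg_of_pos_of_neg (Real.exp_pos _) (hneg t ht)
  have h4 : N t < 1 / (a t₀ - z t₀) := by
    rw [← neg_sub (z t₀), div_neg]
    linarith
  rw [lt_div_iff₀ (by linarith)] at h4
  linarith

/-! ### The integral `I` -/

lemma exists_primitives_integrandI (hp : ContinuousOn p (Ici t₀)) (hq : ContinuousOn q (Ici t₀))
    (hp_pos : ∀ t, t₀ ≤ t → 0 < p t) :
    ∃ Q H : ℝ → ℝ, Q t₀ = 0 ∧ H t₀ = 0 ∧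
      (∀ t ∈ Ici t₀, HasDerivWithinAt Q (q t / p t) (Ici t₀) t) ∧
      (∀ t ∈ Ici t₀, HasDerivWithinAt H (Real.exp (-Q t) / p t) (Ici t₀) t) ∧
      (∀ s ∈ Ici t₀, ∀ t ∈ Ici t₀, ∫ x in s..t, q x / p x = Q t - Q s) ∧
      (IntegrableOn (integrandI p q t₀) (Ioi t₀) → Tendsto H atTop (𝓝 (I p q t₀))) := by
  have hpne : ∀ t ∈ Ici t₀, p t ≠ 0 := fun t ht => (hp_pos t ht).ne'
  obtain ⟨Q, hQ0, hQ, hQi⟩ := exists_primitive (hq.div hp hpne)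
  have hQc : ContinuousOn Q (Ici t₀) := fun t ht => (hQ t ht).continuousWithinAt
  obtain ⟨H, hH0, hH, hHi⟩ := exists_primitive ((hQc.neg.rexp).div hp hpne)
  refine ⟨Q, H, hQ0, hH0, hQ, hH, hQi, fun hI => ?_⟩
  refine (intervalIntegral_tendsto_integral_Ioi t₀ hI tendsto_id).congr' ?_
  filter_upwards [eventually_ge_atTop t₀] with t ht
  have := hHi t₀ self_mem_Ici t ht
  rw [hH0, sub_zero] at this
  rw [← this]
  refine intervalIntegral.integral_congr fun x hx => ?_
  have hx' : t₀ ≤ x := by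
    rw [id, uIcc_of_le ht] at hx
    exact hx.1
  have hQx : ∫ s in t₀..x, q s / p s = Q x := by
    simpa [hQ0] using hQi t₀ self_mem_Ici x hx'
  simp only [integrandI, hQx, Pi.div_apply, Pi.neg_apply, mul_one_div]

/-- Moving the base point to `t₁` only multiplies the integrand by `exp (Q t₁)`. This allows the
bound to be restarted at a later time. -/
lemma integrableOn_integrandI_of_le (hp : ContinuousOn p (Ici t₀)) (hq : ContinuousOn q (Ici t₀))
    (hp_pos : ∀ t, t₀ ≤ t → 0 < p t) (hI : IntegrableOn (integrandI p q t₀) (Ioi t₀)) {t₁ : ℝ}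
    (h : t₀ ≤ t₁) : IntegrableOn (integrandI p q t₁) (Ioi t₁) := by
  obtain ⟨Q, -, hQ0, -, -, -, hQi, -⟩ := exists_primitives_integrandI hp hq hp_pos
  refine IntegrableOn.congr_fun ((hI.mono_set (Ioi_subset_Ioi h)).const_mul (Real.exp (Q t₁)))
    (fun τ hτ => ?_) measurableSet_Ioi
  have hτ' : t₀ ≤ τ := h.trans (le_of_lt hτ)
  simp only [integrandI]
  rw [hQi t₀ self_mem_Ici τ hτ', hQi t₁ h τ hτ', hQ0, ← mul_assoc, ← Real.exp_add]
  ring_nf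

lemma I_pos (hp : ContinuousOn p (Ici t₀)) (hq : ContinuousOn q (Ici t₀))
    (hp_pos : ∀ t, t₀ ≤ t → 0 < p t) (hI : IntegrableOn (integrandI p q t₀) (Ioi t₀)) :
    0 < I p q t₀ := by
  obtain ⟨Q, H, -, hH0, -, hH, -, hlim⟩ := exists_primitives_integrandI hp hq hp_pos
  have hmono := strictMonoOn_Ici hH fun t ht => div_pos (Real.exp_pos _) (hp_pos t ht)
  have h1 : t₀ + 1 ∈ Ici t₀ := by simp
  have h2 : H t₀ < H (t₀ + 1) := hmono self_mem_Ici h1 (by simp)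
  have h3 : H (t₀ + 1) ≤ I p q t₀ := ge_of_tendsto (hlim hI) <| by
    filter_upwards [eventually_ge_atTop (t₀ + 1)] with t ht
    exact hmono.monotoneOn h1 (le_trans h1 ht) ht
  linarith

/-! ### Strict lower bound -/

/-- If `r ≥ 0` does not vanish identically, a regular solution that starts negative stays above
the lower extremal solution `-1 / I` of the equation with `r = 0`. -/
lemma IsRegular.neg_one_div_I_lt {y : ℝ → ℝ} (hy : IsRegular p q r t₀ y)
    (hp : ContinuousOn p (Ici t₀)) (hq : ContinuousOn q (Ici t₀))
    (hp_pos : ∀ t, t₀ ≤ t → 0 < p t) (hr_nonneg : ∀ t, t₀ ≤ t → 0 ≤ r t)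
    (hr : ∃ t, t₀ ≤ t ∧ r t ≠ 0)
    (hI : IntegrableOn (integrandI p q t₀) (Ioi t₀)) : -(1 / I p q t₀) < y t₀ := by
  have hIpos := I_pos hp hq hp_pos hI
  rcases le_or_gt 0 (y t₀) with h0 | h0
  · have : 0 < 1 / I p q t₀ := by positivity
    linarith
  obtain ⟨Q, H, hQ0, hH0, hQ, hH, -, hlim⟩ := exists_primitives_integrandI hp hq hp_pos
  have hneg : ∀ t ∈ Ici t₀, y t < 0 := by
    have hanti : AntitoneOn (fun t => y t * Real.exp (Q t)) (Ici t₀) := by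
      refine antitoneOn_Ici (f' := fun t => -((1 / p t * y t ^ 2 + r t) * Real.exp (Q t)))
        (fun t ht => ((hy t ht).mul (hQ t ht).exp).congr_deriv (by ring)) fun t ht => ?_
      have h1 := hp_pos t ht
      have h2 := hr_nonneg t ht
      have h3 : 0 ≤ (1 / p t * y t ^ 2 + r t) * Real.exp (Q t) := by positivity
      linarith
    intro t ht
    have h1 := hanti self_mem_Ici ht ht
    simp only [hQ0, Real.exp_zero, mul_one] at h1
    by_contra! hc
    have := mul_nonneg hc (Real.exp_pos (Q t)).le
    linarith
  set φ : ℝ → ℝ := fun t => H t - Real.exp (-Q t) / y t with hφ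
  have hφ' : ∀ t ∈ Ici t₀, HasDerivWithinAt φ (-(r t * Real.exp (-Q t) / y t ^ 2)) (Ici t₀) t := by
    intro t ht
    have h1 := (hneg t ht).ne
    have h2 := (hp_pos t ht).ne'
    refine ((hH t ht).sub ((hQ t ht).neg.exp.div (hy t ht) h1)).congr_deriv ?_
    simp only [Pi.neg_apply]
    field_simp
    ring
  have hanti : AntitoneOn φ (Ici t₀) := antitoneOn_Ici hφ' fun t ht => by
    have := hr_nonneg t ht
    have : 0 ≤ r t * Real.exp (-Q t) / y t ^ 2 := by positivity
    linarith
  obtain ⟨s, hs, hrs⟩ := hr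
  have hs1 : s + 1 ∈ Ici t₀ := by simp only [mem_Ici]; linarith
  have hlt : φ (s + 1) < φ t₀ := by
    refine (hanti self_mem_Ici hs1 hs1).lt_of_ne fun heq => ?_
    -- Equality would make `φ` constant on `[s, s + 1]`, so its right derivative at `s` would
    -- vanish, contradicting `r s ≠ 0`.
    have hconst : ∀ x ∈ Ici s ∩ Iio (s + 1), φ x = φ s := by
      have key : ∀ x, t₀ ≤ x → x ≤ s + 1 → φ x = φ t₀ := fun x hx hx' =>
        le_antisymm (hanti self_mem_Ici hx hx) (heq ▸ hanti hx hs1 hx')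
      intro x hx
      rw [key x (le_trans hs hx.1) (le_of_lt hx.2), key s hs (by linarith)]
    have hd : HasDerivWithinAt φ 0 (Ici s) s := by
      refine (hasDerivWithinAt_const s (Ici s) (φ s)).congr_of_eventuallyEq ?_ rfl
      filter_upwards [inter_mem_nhdsWithin (Ici s) (Iio_mem_nhds (lt_add_one s))] with x hx
      exact hconst x hx
    have := (uniqueDiffOn_Ici s s self_mem_Ici).eq_deriv _
      ((hφ' s hs).mono (Ici_subset_Ici.mpr hs)) hd
    have hy0 := (hneg s hs).ne
    simp [hrs, hy0] at this
  have hle : I p q t₀ ≤ φ (s + 1) := le_of_tendsto (hlim hI) <| by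
    filter_upwards [eventually_ge_atTop (s + 1)] with t ht
    have ht' : t₀ ≤ t := le_trans hs1 ht
    have h1 := hanti hs1 ht' ht
    have h2 : Real.exp (-Q t) / y t < 0 := div_neg_of_pos_of_neg (Real.exp_pos _) (hneg t ht')
    simp only [hφ] at h1 ⊢
    linarith
  have h1 : I p q t₀ < -(1 / y t₀) := by
    have : φ t₀ = -(1 / y t₀) := by simp [hφ, hH0, hQ0]
    linarith
  rw [← one_div_neg_eq_neg_one_div, lt_div_iff₀ (by linarith)] at h1
  have h2 : -y t₀ < 1 / I p q t₀ := by
    rw [lt_div_iff₀ hIpos]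
    linarith
  linarith

/-! ### Existence of the lower extremal solution -/

/-- Below the positive regular solution `a` there is a lowest regular solution. -/
lemma exists_isLowerExtremal {a : ℝ → ℝ} (hp : ContinuousOn p (Ici t₀))
    (hq : ContinuousOn q (Ici t₀)) (hp_pos : ∀ t, t₀ ≤ t → 0 < p t)
    (hI : IntegrableOn (integrandI p q t₀) (Ioi t₀))
    (ha : IsRegular p q r t₀ a) (ha_pos : ∀ t, t₀ ≤ t → 0 < a t) :
    ∃ y, IsLowerExtremal p q r t₀ y := by
  have hpne : ∀ t ∈ Ici t₀, p t ≠ 0 := fun t ht => (hp_pos t ht).ne'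
  obtain ⟨Q, H, hQ0, hH0, hQ, hH, -, hlim⟩ := exists_primitives_integrandI hp hq hp_pos
  obtain ⟨A, hA0, hA, -⟩ := exists_primitive
    (((continuousOn_const (c := (2 : ℝ))).mul ha.continuousOn |>.add hq).div hp hpne)
  have hAc : ContinuousOn A (Ici t₀) := fun t ht => (hA t ht).continuousWithinAt
  obtain ⟨N, hN0, hN, -⟩ := exists_primitive ((hAc.neg.rexp).div hp hpne)
  have hQA : ∀ t ∈ Ici t₀, Q t ≤ A t := fun t ht => by
    have := monotoneOn_Ici (fun s hs => (hA s hs).sub (hQ s hs)) (fun s hs => by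
      have h1 := hp_pos s hs
      have h2 := ha_pos s hs
      have : 0 < 2 * a s / p s := by positivity
      change 0 ≤ (2 * a s + q s) / p s - q s / p s
      rw [add_div]
      linarith) self_mem_Ici ht ht
    simp only [Pi.sub_apply, hA0, hQ0] at this
    linarith
  have hNH : ∀ t ∈ Ici t₀, N t ≤ H t := fun t ht => by
    have := monotoneOn_Ici (fun s hs => (hH s hs).sub (hN s hs)) (fun s hs => by
      have h1 := (hp_pos s hs).le
      have h2 : Real.exp (-A s) ≤ Real.exp (-Q s) :=
        Real.exp_le_exp.mpr (neg_le_neg (hQA s hs))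
      exact sub_nonneg.mpr (div_le_div_of_nonneg_right h2 h1)) self_mem_Ici ht ht
    simp only [Pi.sub_apply, hH0, hN0] at this
    linarith
  have hHmono := strictMonoOn_Ici hH fun t ht => div_pos (Real.exp_pos _) (hp_pos t ht)
  have hNmono : StrictMonoOn N (Ici t₀) :=
    strictMonoOn_Ici hN fun t ht => div_pos (Real.exp_pos _) (hp_pos t ht)
  have hHI : ∀ t ∈ Ici t₀, H t ≤ I p q t₀ := fun t ht => ge_of_tendsto (hlim hI) <| by
    filter_upwards [eventually_ge_atTop t] with s hs
    exact hHmono.monotoneOn ht (le_trans ht hs) hs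
  obtain ⟨ν, hν⟩ : ∃ ν, IsLUB (N '' Ici t₀) ν := Real.exists_isLUB
    ⟨_, mem_image_of_mem N self_mem_Ici⟩
    ⟨I p q t₀, by rintro _ ⟨t, ht, rfl⟩; exact (hNH t ht).trans (hHI t ht)⟩
  -- The supremum is not attained, so the denominator `1 - N/ν` below stays positive.
  have hNν : ∀ t ∈ Ici t₀, N t < ν := fun t ht => by
    have h1 : t + 1 ∈ Ici t₀ := le_trans ht (lt_add_one t).le
    exact (hNmono ht h1 (lt_add_one t)).trans_le (hν.1 (mem_image_of_mem N h1))
  have hνpos : 0 < ν := hN0 ▸ hNν t₀ self_mem_Ici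
  set y : ℝ → ℝ := fun t => a t + (-1 / ν) * Real.exp (-A t) / (1 + (-1 / ν) * N t) with hydef
  have hy : IsRegular p q r t₀ y := by
    refine IsSolutionOn.add_div ha hA hN hpne _ fun t ht => ne_of_gt ?_
    have : N t / ν < 1 := (div_lt_one hνpos).mpr (hNν t ht)
    have h2 : -1 / ν * N t = -(N t / ν) := by ring
    linarith
  have hy0 : y t₀ = a t₀ - 1 / ν := by
    simp only [hydef, hA0, hN0, neg_zero, Real.exp_zero, mul_one, mul_zero, add_zero, div_one]
    ring
  have hinv : 0 < 1 / ν := by positivity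
  have hlow : ∀ z, IsRegular p q r t₀ z → y t₀ ≤ z t₀ := by
    intro z hz
    by_contra! hlt
    have hd : 1 / ν < a t₀ - z t₀ := by linarith
    have hbound : ν ≤ 1 / (a t₀ - z t₀) := hν.2 <| by
      rintro _ ⟨t, ht, rfl⟩
      rw [le_div_iff₀ (hinv.trans hd), mul_comm]
      exact (ha.mul_lt_one hz hp hq hp_pos hA0 hN0 hA hN (by linarith) ht).le
    have := one_div_le_one_div_of_le hνpos hbound
    rw [one_div_one_div] at this
    linarith
  have hlow' : ∀ (T : ℝ) (z : ℝ → ℝ), t₀ < T → z t₀ < y t₀ → ¬ ExtendsToRegular p q r t₀ T z := by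
    rintro T z hT hlt ⟨w, hw, hwz⟩
    have := hlow w hw
    rw [hwz ⟨le_rfl, hT⟩] at this
    linarith
  refine ⟨y, ⟨hy, ?_⟩, fun T z hT _ => hlow' T z hT⟩
  rintro ⟨-, U, hU, hUreg⟩
  obtain ⟨ε, hε, hball⟩ := Metric.mem_nhds_iff.mp hU
  -- This offset starts `ε/2` below `y t₀`, inside `U`. The resulting solution need only exist near
  -- `t₀`: normality would extend it, contradicting minimality.
  set δ : ℝ := -1 / ν - ε / 2 with hδ
  have hNc : ContinuousWithinAt N (Ici t₀) t₀ := (hN t₀ self_mem_Ici).continuousWithinAt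
  have hev : ∀ᶠ t in 𝓝[Ici t₀] t₀, 1 + δ * N t ≠ 0 :=
    (continuousWithinAt_const.add (continuousWithinAt_const.mul hNc)).eventually_ne (by simp [hN0])
  obtain ⟨T, hT, hTsub⟩ := (mem_nhdsGE_iff_exists_Ico_subset).mp hev
  have hsub : Ico t₀ T ⊆ Ici t₀ := Ico_subset_Ici_self
  have hz := (ha.mono hsub).add_div (fun t ht => (hA t (hsub ht)).mono hsub)
    (fun t ht => (hN t (hsub ht)).mono hsub) (fun t ht => hpne t (hsub ht)) δ
    (fun t ht => hTsub ht)
  have hz0 : a t₀ + δ * Real.exp (-A t₀) / (1 + δ * N t₀) = y t₀ - ε / 2 := by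
    rw [hy0, hA0, hN0, hδ]
    simp
    ring
  refine hlow' T _ hT (by rw [hz0]; linarith) (hUreg T _ hT hz (hball ?_))
  rw [hz0, Metric.mem_ball, Real.dist_eq, sub_sub_cancel_left, abs_neg, abs_of_pos (by linarith)]
  linarith

lemma IsLowerExtremal.le_of_isRegular {y z : ℝ → ℝ} (hy : IsLowerExtremal p q r t₀ y)
    (hz : IsRegular p q r t₀ z) : y t₀ ≤ z t₀ := by
  by_contra! h
  exact hy.2 (t₀ + 1) z (by linarith) (hz.mono Ico_subset_Ici_self) h ⟨z, hz, fun _ _ => rfl⟩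

end Riccati

theorem lemma2p6 (t₀ : ℝ) (p q r : ℝ → ℝ)
    (hp : ContinuousOn p (Ici t₀)) (hq : ContinuousOn q (Ici t₀)) (hr : ContinuousOn r (Ici t₀))
    (hp_pos : ∀ t, t₀ ≤ t → 0 < p t)
    (hr_nonneg : ∀ t, t₀ ≤ t → 0 ≤ r t)
    (hr_supp : ¬ BddAbove {t : ℝ | t₀ ≤ t ∧ r t ≠ 0})
    (hI : IntegrableOn (Riccati.integrandI p q t₀) (Ioi t₀))
    (hnormal : ∃ αp : ℝ → ℝ, Riccati.IsNormal p q r t₀ αp ∧ ∀ t, t₀ ≤ t → 0 < αp t) :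
    ∃ αs : ℝ → ℝ, Riccati.IsLowerExtremal p q r t₀ αs ∧
      (∀ β : ℝ → ℝ, Riccati.IsLowerExtremal p q r t₀ β → EqOn β αs (Ici t₀)) ∧
      ∀ t, t₀ ≤ t → αs t > -(1 / Riccati.I p q t) := by
  obtain ⟨a, ha, ha_pos⟩ := hnormal
  obtain ⟨y, hy⟩ := Riccati.exists_isLowerExtremal hp hq hp_pos hI ha.1 ha_pos
  refine ⟨y, hy, fun β hβ => ?_, fun t ht => ?_⟩
  · exact hy.1.1.eqOn hβ.1.1 hp hq hp_pos
      (le_antisymm (hβ.le_of_isRegular hy.1.1) (hy.le_of_isRegular hβ.1.1))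
  · have hsub : Ici t ⊆ Ici t₀ := Ici_subset_Ici.mpr ht
    obtain ⟨s, ⟨-, hs⟩, hts⟩ := not_bddAbove_iff.mp hr_supp t
    exact Riccati.IsRegular.neg_one_div_I_lt (hy.1.1.mono hsub) (hp.mono hsub) (hq.mono hsub)
      (fun s hs => hp_pos s (ht.trans hs)) (fun s hs => hr_nonneg s (ht.trans hs))
      ⟨s, hts.le, hs⟩ (Riccati.integrableOn_integrandI_of_le hp hq hp_pos hI ht)
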